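/- Let $\mathbb H\in\{\mathbb R,\mathbb C\}$, let $m,d$ be positive integers and let $A\in\mathbb H^{m\times d}$, where $d\ge 2$ or $A=0$. Then there exists $b\in\mathbb R^m$ such that the least squares problem $$\min_{x\in\mathbb H^d}\ \big\|\,|Ax|-b\,\big\|^2$$ (where $|\cdot|$ acts entrywise and $\|\cdot\|$ is the Euclidean norm on $\mathbb R^m$) does not have a unique solution up to a unimodular constant; that is, there are two global minimizers $x_1,x_2\in\mathbb H^d$ such that $x_1\ne c\,x_2$ for every $c\in\mathbb H$ with $|c|=1$. -/

import Mathlib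

open scoped Matrix

/-- The entrywise modulus `|A x|`, as a vector of `ℝ^m` with the Euclidean norm. -/
noncomputable def absMulVec {𝕜 : Type*} [RCLike 𝕜] {m d : ℕ}
    (A : Matrix (Fin m) (Fin d) 𝕜) (x : Fin d → 𝕜) : EuclideanSpace ℝ (Fin m) :=
  WithLp.toLp 2 (fun i => ‖(A *ᵥ x) i‖)

/-- The solution set `Φ_A(b)`: all global minimizers over `x ∈ 𝕜^d` of `‖|A x| - b‖²`. -/
def leastSquaresSolutions {𝕜 : Type*} [RCLike 𝕜] {m d : ℕ}
    (A : Matrix (Fin m) (Fin d) 𝕜) (b : EuclideanSpace ℝ (Fin m)) : Set (Fin d → 𝕜) :=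
  {x | ∀ y : Fin d → 𝕜, ‖absMulVec A x - b‖ ^ 2 ≤ ‖absMulVec A y - b‖ ^ 2}

/-- The relation `x ∼ y` on `𝕜^d`: `x = c y` for some unimodular constant `c`. -/
def phaseSetoid (𝕜 : Type*) [RCLike 𝕜] (d : ℕ) : Setoid (Fin d → 𝕜) where
  r x y := ∃ c : 𝕜, ‖c‖ = 1 ∧ x = c • y
  iseqv :=
    { refl := fun x => ⟨1, by simp, by simp⟩
      symm := by
        rintro x y ⟨c, hc, rfl⟩
        have h0 : c ≠ 0 := by
          rintro rfl
          simp at hc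
        exact ⟨c⁻¹, by simp [hc], by rw [smul_smul, inv_mul_cancel₀ h0, one_smul]⟩
      trans := by
        rintro x y z ⟨c, hc, rfl⟩ ⟨e, he, rfl⟩
        exact ⟨c * e, by simp [hc, he], by rw [smul_smul]⟩ }

/-- The set of classes in `𝕜^d / ∼` of the solutions in `Φ_A(b)`. -/
def solutionClasses {𝕜 : Type*} [RCLike 𝕜] {m d : ℕ}
    (A : Matrix (Fin m) (Fin d) 𝕜) (b : EuclideanSpace ℝ (Fin m)) :
    Set (Quotient (phaseSetoid 𝕜 d)) :=
  Quotient.mk (phaseSetoid 𝕜 d) '' leastSquaresSolutions A b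

open Filter Topology
open scoped RealInnerProductSpace

/-! ### Convexity of closed cones with unique nearest points. -/

section ChebyshevCone

variable {E : Type*} [NormedAddCommGroup E] [InnerProductSpace ℝ E]

/-! Suppose solutions are unique up to phase for every `b`. Data `b = |A y|` show that `x ↦ |A x|`
is injective up to phase, so its range is a closed cone with unique nearest points, hence convex
(`add_mem_of_unique_nearest`).

This fails (`PhaseInjective.not_add_mem_range`). As `d ≥ 2`, a nonzero row `j` kills some `x ≠ 0`
but not some `y`. The midpoint of `|A (x ± t y)|` has squared entries within `O(t²)` of those of `|A
x|`, while its entry `j` is linear in `t`. If it is `|A (x + w)|` with the phase normalized, entry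
`j` gives `t = O(‖w‖)`, and `PhaseInjective.ker_phaseDifferential` gives `‖w‖ = O(t² + ‖w‖²) =
O(‖w‖²)`, impossible as `w → 0`. -/

theorem norm_sub_sq_le_iff_inner (p k b : E) :
    ‖p - b‖ ^ 2 ≤ ‖k - b‖ ^ 2 ↔ ⟪k, b⟫ - ‖k‖ ^ 2 / 2 ≤ ⟪p, b⟫ - ‖p‖ ^ 2 / 2 := by
  rw [norm_sub_sq_real, norm_sub_sq_real]
  constructor <;> intro h <;> linarith

/-- A nearest point `p` of a cone to `b` satisfies `⟪p, b⟫ = ‖p‖²`. -/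
theorem inner_eq_norm_sq_of_nearest {K : Set E} (hcone : ∀ k ∈ K, ∀ r : ℝ, 0 ≤ r → r • k ∈ K)
    {p b : E} (hp : p ∈ K) (hmax : ∀ k ∈ K, ⟪k, b⟫ - ‖k‖ ^ 2 / 2 ≤ ⟪p, b⟫ - ‖p‖ ^ 2 / 2) :
    ⟪p, b⟫ = ‖p‖ ^ 2 := by
  have key : ∀ r : ℝ, 0 ≤ r → r * ⟪p, b⟫ - r ^ 2 * ‖p‖ ^ 2 / 2 ≤ ⟪p, b⟫ - ‖p‖ ^ 2 / 2 := by
    intro r hr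
    have := hmax _ (hcone p hp r hr)
    rwa [real_inner_smul_left, norm_smul, mul_pow, Real.norm_eq_abs, sq_abs] at this
  rcases (norm_nonneg p).eq_or_lt with h0 | h0
  · rw [norm_eq_zero.mp h0.symm]; simp
  · have hb : 0 < ‖p‖ ^ 2 := by positivity
    have h1 := key 0 le_rfl
    have hr : 0 ≤ ⟪p, b⟫ / ‖p‖ ^ 2 := by
      apply div_nonneg _ hb.le
      linarith
    have h2 := key _ hr
    set β := ‖p‖ ^ 2
    have h3 : ⟪p, b⟫ / β * β = ⟪p, b⟫ := div_mul_cancel₀ _ hb.ne'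
    set s := ⟪p, b⟫ / β
    rw [← h3] at h2 ⊢
    have h4 : β * (s - 1) ^ 2 ≤ 0 := by nlinarith
    have h5 : (s - 1) ^ 2 ≤ 0 := by
      by_contra h
      push Not at h
      have := mul_pos hb h
      linarith
    have h6 : s - 1 = 0 := by
      apply pow_eq_zero_iff (two_ne_zero) |>.mp (le_antisymm h5 (sq_nonneg _))
    rw [sub_eq_zero.mp h6, one_mul]

/-- Compare `p` with the best multiple of `k`, namely `(⟪k, b⟫ / ‖k‖²) • k`. -/
theorem inner_le_norm_mul_norm_of_nearest {K : Set E}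
    (hcone : ∀ k ∈ K, ∀ r : ℝ, 0 ≤ r → r • k ∈ K) {p b k : E} (hp : p ∈ K)
    (hmax : ∀ k ∈ K, ⟪k, b⟫ - ‖k‖ ^ 2 / 2 ≤ ⟪p, b⟫ - ‖p‖ ^ 2 / 2) (hk : k ∈ K) :
    ⟪k, b⟫ ≤ ‖p‖ * ‖k‖ := by
  have hpb := inner_eq_norm_sq_of_nearest hcone hp hmax
  rcases le_or_gt ⟪k, b⟫ 0 with h0 | h0
  · exact h0.trans (by positivity)
  have hk0 : 0 < ‖k‖ := by
    rw [norm_pos_iff]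
    rintro rfl
    simp at h0
  have h := hmax _ (hcone k hk (⟪k, b⟫ / ‖k‖ ^ 2) (by positivity))
  rw [real_inner_smul_left, norm_smul, mul_pow, Real.norm_eq_abs, sq_abs, hpb] at h
  have h1 : ⟪k, b⟫ ^ 2 / ‖k‖ ^ 2 ≤ ‖p‖ ^ 2 := by
    have e1 : ⟪k, b⟫ / ‖k‖ ^ 2 * ⟪k, b⟫ - (⟪k, b⟫ / ‖k‖ ^ 2) ^ 2 * ‖k‖ ^ 2 / 2
        = ⟪k, b⟫ ^ 2 / ‖k‖ ^ 2 / 2 := by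
      field_simp
      ring
    linarith
  rw [div_le_iff₀ (by positivity), ← mul_pow] at h1
  exact le_of_sq_le_sq h1 (by positivity)

variable [FiniteDimensional ℝ E]

/-- A finite-dimensional Motzkin theorem for cones: a closed cone in which nearest points are
unique is closed under addition. -/
theorem add_mem_of_unique_nearest {K : Set E} (hclosed : IsClosed K)
    (hcone : ∀ k ∈ K, ∀ r : ℝ, 0 ≤ r → r • k ∈ K)
    (huniq : ∀ b, ∀ p ∈ K, ∀ q ∈ K, (∀ k ∈ K, ‖p - b‖ ^ 2 ≤ ‖k - b‖ ^ 2) →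
      (∀ k ∈ K, ‖q - b‖ ^ 2 ≤ ‖k - b‖ ^ 2) → p = q)
    {k₁ k₂ : E} (h₁ : k₁ ∈ K) (h₂ : k₂ ∈ K) : k₁ + k₂ ∈ K := by
  have hne : K.Nonempty := ⟨k₁, h₁⟩
  have h0K : (0 : E) ∈ K := by simpa using hcone k₁ h₁ 0 le_rfl
  have hex : ∀ b, ∃ p ∈ K, Metric.infDist b K = dist b p := fun b =>
    hclosed.exists_infDist_eq_dist hne b
  choose P hPK hPd using hex
  have hnear : ∀ b, ∀ k ∈ K, ‖P b - b‖ ^ 2 ≤ ‖k - b‖ ^ 2 := by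
    intro b k hk
    have := Metric.infDist_le_dist_of_mem (x := b) hk
    rw [hPd, dist_comm, dist_comm b, dist_eq_norm, dist_eq_norm] at this
    gcongr
  have hmax : ∀ b, ∀ k ∈ K, ⟪k, b⟫ - ‖k‖ ^ 2 / 2 ≤ ⟪P b, b⟫ - ‖P b‖ ^ 2 / 2 := fun b k hk =>
    (norm_sub_sq_le_iff_inner _ _ _).mp (hnear b k hk)
  have hPb : ∀ b, ⟪P b, b⟫ = ‖P b‖ ^ 2 := fun b =>
    inner_eq_norm_sq_of_nearest hcone (hPK b) (hmax b)
  have hPle : ∀ b, ‖P b‖ ≤ ‖b‖ := by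
    intro b
    have h := real_inner_le_norm (P b) b
    rw [hPb] at h
    by_contra hlt
    push Not at hlt
    nlinarith [norm_nonneg b]
  -- Limit points of `P (u n)` are nearest to `b`, so uniqueness identifies them with `P b`.
  have hPcont : ∀ (b : E) (u : ℕ → E), Tendsto u atTop (𝓝 b) →
      ∃ φ : ℕ → ℕ, StrictMono φ ∧ Tendsto (fun n => P (u (φ n))) atTop (𝓝 (P b)) := by
    intro b u hu
    obtain ⟨R, hR⟩ := hu.norm.bddAbove_range
    have hmem : ∀ n, P (u n) ∈ Metric.closedBall (0 : E) R := by
      intro n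
      rw [mem_closedBall_zero_iff]
      exact (hPle _).trans (hR ⟨n, rfl⟩)
    obtain ⟨q, -, φ, hφ, hq⟩ := (isCompact_closedBall (0 : E) R).tendsto_subseq hmem
    refine ⟨φ, hφ, ?_⟩
    have huφ := hu.comp hφ.tendsto_atTop
    have hqK : q ∈ K := hclosed.mem_of_tendsto hq (Eventually.of_forall fun n => hPK _)
    have hqP : P b = q := by
      refine huniq b _ (hPK b) _ hqK (hnear b) fun k hk => ?_
      exact le_of_tendsto_of_tendsto' ((hq.sub huφ).norm.pow 2)
        ((tendsto_const_nhds.sub huφ).norm.pow 2) fun n => hnear _ k hk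
    rw [hqP]
    exact hq
  set p := k₁ + k₂ with hp
  set M := ‖k₁‖ + ‖k₂‖ with hM
  have hM0 : 0 ≤ M := by positivity
  have happrox : ∀ ε : ℝ, 0 < ε → ∃ q ∈ K, ‖p - q‖ ^ 2 ≤ ε * M ^ 2 := by
    intro ε hε
    -- The first term is the supremum over `k ∈ K` of `⟪k, b⟫ - ‖k‖² / 2`, with gradient `P b`; a
    -- minimizer of `G` thus solves `P b + ε • b = p`.
    let G : E → ℝ := fun b =>
      (‖b‖ ^ 2 - Metric.infDist b K ^ 2) / 2 + ε / 2 * ‖b‖ ^ 2 - ⟪p, b⟫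
    have hG : ∀ b, G b = ⟪P b, b⟫ - ‖P b‖ ^ 2 / 2 + ε / 2 * ‖b‖ ^ 2 - ⟪p, b⟫ := by
      intro b
      simp only [G]
      rw [hPd, dist_comm, dist_eq_norm, norm_sub_sq_real]
      ring
    have hGc : Continuous G := by
      have := Metric.continuous_infDist_pt K
      fun_prop
    obtain ⟨b, hb⟩ : ∃ b, ∀ c, G b ≤ G c := by
      refine hGc.exists_forall_le' 0 ?_
      have hev : ∀ᶠ c in cocompact E, 2 * ‖p‖ / ε ≤ ‖c‖ :=
        (tendsto_norm_cocompact_atTop (E := E)).eventually_ge_atTop _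
      filter_upwards [hev] with c hc
      have h0 : G 0 = 0 := by
        rw [hG, hPb]
        have := hPle 0
        rw [norm_zero] at this
        have := le_antisymm this (norm_nonneg _)
        simp [this]
      rw [h0, hG, hPb]
      have h1 := real_inner_le_norm p c
      rw [div_le_iff₀ hε] at hc
      nlinarith [norm_nonneg c, sq_nonneg ‖P c‖]
    have hfoc : P b + ε • b = p := by
      set v := p - (P b + ε • b) with hv
      let t : ℕ → ℝ := fun n => 1 / ((n : ℝ) + 1)
      have ht0 : ∀ n, 0 < t n := fun n => Nat.one_div_pos_of_nat
      have htl : Tendsto t atTop (𝓝 0) := tendsto_one_div_add_atTop_nhds_zero_nat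
      have hu : Tendsto (fun n => b + t n • v) atTop (𝓝 b) := by
        simpa using tendsto_const_nhds.add (htl.smul_const v)
      obtain ⟨φ, hφ, hlim⟩ := hPcont b _ hu
      -- Minimality of `G` at `b` against a step along `v`, minus its gradient there; the limit is
      -- `0 ≤ -‖v‖²`.
      have hineq : ∀ n, 0 ≤ ⟪P (b + t (φ n) • v) + ε • b - p, v⟫
          + t (φ n) * (ε / 2 * ‖v‖ ^ 2) := by
        intro n
        set s := t (φ n)
        set c := b + s • v with hc
        have hs : 0 < s := ht0 _
        have h1 := hb c
        rw [hG, hG] at h1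
        have h2 := hmax b (P c) (hPK c)
        have h3 : ⟪P c, c⟫ = ⟪P c, b⟫ + s * ⟪P c, v⟫ := by
          rw [hc, inner_add_right, real_inner_smul_right]
        have h4 : ‖c‖ ^ 2 = ‖b‖ ^ 2 + 2 * (s * ⟪b, v⟫) + s ^ 2 * ‖v‖ ^ 2 := by
          rw [hc, norm_add_sq_real, real_inner_smul_right, norm_smul, mul_pow, Real.norm_eq_abs,
            sq_abs]
        have h5 : ⟪p, c⟫ = ⟪p, b⟫ + s * ⟪p, v⟫ := by
          rw [hc, inner_add_right, real_inner_smul_right]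
        rw [inner_sub_left, inner_add_left, real_inner_smul_left]
        have h6 : 0 ≤ s * (⟪P c, v⟫ + ε * ⟪b, v⟫ - ⟪p, v⟫ + s * (ε / 2 * ‖v‖ ^ 2)) := by
          rw [h3, h4, h5] at h1
          linarith
        exact nonneg_of_mul_nonneg_right h6 hs
      have hl : Tendsto (fun n => ⟪P (b + t (φ n) • v) + ε • b - p, v⟫
          + t (φ n) * (ε / 2 * ‖v‖ ^ 2)) atTop (𝓝 (⟪P b + ε • b - p, v⟫ + 0 * (ε / 2 * ‖v‖ ^ 2))) :=
        (((hlim.add_const _).sub_const _).inner tendsto_const_nhds).add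
          ((htl.comp hφ.tendsto_atTop).mul_const _)
      have h0 := ge_of_tendsto' hl hineq
      have hvn : P b + ε • b - p = -v := by rw [hv]; abel
      rw [hvn, inner_neg_left, real_inner_self_eq_norm_sq] at h0
      have hv0 : ‖v‖ = 0 := by nlinarith [norm_nonneg v]
      have := norm_eq_zero.mp hv0
      rw [hv, sub_eq_zero] at this
      exact this.symm
    refine ⟨P b, hPK b, ?_⟩
    have h1 := inner_le_norm_mul_norm_of_nearest hcone (hPK b) (hmax b) h₁
    have h2 := inner_le_norm_mul_norm_of_nearest hcone (hPK b) (hmax b) h₂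
    have h3 : ⟪p, b⟫ ≤ ‖P b‖ * M := by
      rw [hp, inner_add_left, hM, mul_add]
      linarith
    have h4 : ⟪p, b⟫ = ‖P b‖ ^ 2 + ε * ‖b‖ ^ 2 := by
      rw [← hfoc, inner_add_left, hPb, real_inner_smul_left, real_inner_self_eq_norm_sq]
    -- `ε‖b‖² ≤ ‖P b‖ M - ‖P b‖²`, a quadratic in `‖P b‖` bounded by `M²`.
    have h5 : ε * ‖b‖ ^ 2 ≤ M ^ 2 := by
      nlinarith [sq_nonneg (‖P b‖ - M), sq_nonneg (‖P b‖)]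
    have h6 : p - P b = ε • b := by rw [← hfoc]; abel
    rw [h6, norm_smul, mul_pow, Real.norm_eq_abs, sq_abs]
    nlinarith
  have hcl : p ∈ closure K := by
    rw [Metric.mem_closure_iff]
    intro δ hδ
    obtain ⟨q, hq, hle⟩ := happrox (δ ^ 2 / (2 * (M ^ 2 + 1))) (by positivity)
    refine ⟨q, hq, ?_⟩
    rw [dist_eq_norm]
    refine lt_of_pow_lt_pow_left₀ 2 hδ.le (hle.trans_lt ?_)
    rw [div_mul_eq_mul_div, div_lt_iff₀ (by positivity)]
    have : 0 < δ ^ 2 := by positivity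
    nlinarith [mul_nonneg this.le (sq_nonneg M)]
  rwa [hclosed.closure_eq] at hcl

end ChebyshevCone

/-! ### Closedness of the range of `|A ·|` and its infinitesimal injectivity. -/

section PhaseRetrieval

variable {𝕜 : Type*} [RCLike 𝕜] {m d : ℕ} {A : Matrix (Fin m) (Fin d) 𝕜}

@[simp]
theorem absMulVec_apply (A : Matrix (Fin m) (Fin d) 𝕜) (x : Fin d → 𝕜) (i : Fin m) :
    absMulVec A x i = ‖(A *ᵥ x) i‖ := rfl

theorem absMulVec_smul (A : Matrix (Fin m) (Fin d) 𝕜) (c : 𝕜) (x : Fin d → 𝕜) :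
    absMulVec A (c • x) = ‖c‖ • absMulVec A x := by
  ext i
  simp [Matrix.mulVec_smul]

theorem continuous_absMulVec (A : Matrix (Fin m) (Fin d) 𝕜) : Continuous (absMulVec A) := by
  unfold absMulVec
  refine (PiLp.continuous_toLp 2 _).comp (continuous_pi fun i => ?_)
  exact ((continuous_apply i).comp (A.mulVecLin.continuous_of_finiteDimensional)).norm

theorem norm_mulVec_le_norm_absMulVec (A : Matrix (Fin m) (Fin d) 𝕜) (x : Fin d → 𝕜) :
    ‖A *ᵥ x‖ ≤ ‖absMulVec A x‖ := by
  refine (pi_norm_le_iff_of_nonneg (norm_nonneg _)).mpr fun i => ?_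
  simpa using PiLp.norm_apply_le (absMulVec A x) i

/-- `A` does phase retrieval: `x ↦ |A x|` is injective up to unimodular constants. -/
def PhaseInjective (A : Matrix (Fin m) (Fin d) 𝕜) : Prop :=
  ∀ x y, absMulVec A x = absMulVec A y → ∃ c : 𝕜, ‖c‖ = 1 ∧ x = c • y

theorem PhaseInjective.ker_mulVecLin (hA : PhaseInjective A) :
    LinearMap.ker A.mulVecLin = ⊥ := by
  refine LinearMap.ker_eq_bot'.mpr fun x hx => ?_
  rw [Matrix.mulVecLin_apply] at hx
  obtain ⟨c, -, hc⟩ := hA x 0 (by ext i; simp [hx])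
  simpa using hc

theorem PhaseInjective.exists_tendsto_subseq (hA : PhaseInjective A) {z : ℕ → Fin d → 𝕜}
    {q : EuclideanSpace ℝ (Fin m)} (hz : Tendsto (fun n => absMulVec A (z n)) atTop (𝓝 q)) :
    ∃ a, ∃ φ : ℕ → ℕ, StrictMono φ ∧ Tendsto (z ∘ φ) atTop (𝓝 a) := by
  obtain ⟨N, -, hN⟩ := A.mulVecLin.exists_antilipschitzWith hA.ker_mulVecLin
  obtain ⟨R, hR⟩ := hz.norm.bddAbove_range
  have hmem : ∀ n, z n ∈ Metric.closedBall (0 : Fin d → 𝕜) (N * R) := by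
    intro n
    rw [mem_closedBall_zero_iff]
    have h1 := hN.le_mul_dist (z n) 0
    rw [map_zero, dist_zero_right, dist_zero_right, Matrix.mulVecLin_apply] at h1
    refine h1.trans ?_
    gcongr
    exact (norm_mulVec_le_norm_absMulVec A _).trans (hR ⟨n, rfl⟩)
  obtain ⟨a, -, φ, hφ, ha⟩ := (isCompact_closedBall (0 : Fin d → 𝕜) (N * R)).tendsto_subseq hmem
  exact ⟨a, φ, hφ, ha⟩

theorem PhaseInjective.isClosed_range (hA : PhaseInjective A) :
    IsClosed (Set.range (absMulVec A)) := by
  refine IsSeqClosed.isClosed fun u q hu hq => ?_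
  choose z hz using hu
  obtain rfl : (fun n => absMulVec A (z n)) = u := funext hz
  obtain ⟨a, φ, hφ, ha⟩ := hA.exists_tendsto_subseq hq
  exact ⟨a, tendsto_nhds_unique (((continuous_absMulVec A).tendsto a).comp ha)
    (hq.comp hφ.tendsto_atTop)⟩

/-- The differential at `x` of `w ↦ |A w|² / 2`, together with the component of `w` along the
phase orbit of `x`. -/
noncomputable def phaseDifferential (A : Matrix (Fin m) (Fin d) 𝕜) (x : Fin d → 𝕜) :
    (Fin d → 𝕜) →ₗ[ℝ] (Fin m → ℝ) × ℝ where
  toFun w := (fun i => RCLike.re (inner 𝕜 ((A *ᵥ x) i) ((A *ᵥ w) i)),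
    RCLike.im (star x ⬝ᵥ w))
  map_add' v w := by
    ext
    · simp [Matrix.mulVec_add]
      ring
    · simp [dotProduct_add]
  map_smul' r w := by
    ext <;> simp [Matrix.mulVec_smul, dotProduct_smul, RCLike.real_smul_eq_coe_mul]
    ring

theorem star_dotProduct_self_eq_ofReal {x : Fin d → 𝕜} (hx : x ≠ 0) :
    ∃ S : ℝ, 0 < S ∧ star x ⬝ᵥ x = (S : 𝕜) := by
  refine ⟨∑ i, ‖x i‖ ^ 2, ?_, ?_⟩
  · obtain ⟨i, hi⟩ := Function.ne_iff.mp hx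
    refine Finset.sum_pos' (fun _ _ => by positivity) ⟨i, Finset.mem_univ _, ?_⟩
    have : 0 < ‖x i‖ := norm_pos_iff.mpr hi
    positivity
  · simp [dotProduct, RCLike.conj_mul]

/-- For `w` in the kernel, `|A (x + w)| = |A (x - w)|`, so `x + w = c (x - w)`. Pairing with `x`,
where `⟨x, w⟩` is real, forces `⟨x, w⟩ = 0` and `c = 1`. -/
theorem PhaseInjective.ker_phaseDifferential (hA : PhaseInjective A) {x : Fin d → 𝕜}
    (hx : x ≠ 0) : LinearMap.ker (phaseDifferential A x) = ⊥ := by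
  refine LinearMap.ker_eq_bot'.mpr fun w hw => ?_
  have hre : ∀ i, RCLike.re (inner 𝕜 ((A *ᵥ x) i) ((A *ᵥ w) i)) = 0 := fun i =>
    congrFun (congrArg Prod.fst hw) i
  have him : RCLike.im (star x ⬝ᵥ w) = 0 := congrArg Prod.snd hw
  obtain ⟨c, hc, h⟩ := hA (x + w) (x - w) (by
    ext i
    simp only [absMulVec_apply, Matrix.mulVec_add, Matrix.mulVec_sub, Pi.add_apply, Pi.sub_apply]
    rw [← sq_eq_sq₀ (norm_nonneg _) (norm_nonneg _), norm_add_sq (𝕜 := 𝕜),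
      norm_sub_sq (𝕜 := 𝕜), hre]
    ring)
  obtain ⟨S, hS, hSx⟩ := star_dotProduct_self_eq_ofReal hx
  obtain ⟨τ, hτ⟩ : ∃ τ : ℝ, star x ⬝ᵥ w = (τ : 𝕜) :=
    ⟨_, (RCLike.ext (by simp) (by simp [him]) :
      star x ⬝ᵥ w = ((RCLike.re (star x ⬝ᵥ w) : ℝ) : 𝕜))⟩
  have hdot := congrArg (fun v => star x ⬝ᵥ v) h
  simp only [dotProduct_add, dotProduct_smul, dotProduct_sub, hSx, hτ, smul_eq_mul] at hdot
  have hn := congrArg norm hdot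
  rw [norm_mul, hc, one_mul, ← RCLike.ofReal_add, ← RCLike.ofReal_sub, RCLike.norm_ofReal,
    RCLike.norm_ofReal, ← sq_eq_sq₀ (abs_nonneg _) (abs_nonneg _), sq_abs, sq_abs] at hn
  have hτ0 : τ = 0 := by
    have : S * τ = 0 := by linarith
    exact (mul_eq_zero.mp this).resolve_left hS.ne'
  have hc1 : c = 1 := by
    have hS' : (S : 𝕜) ≠ 0 := RCLike.ofReal_ne_zero.mpr hS.ne'
    rw [hτ0, RCLike.ofReal_zero, add_zero, sub_zero] at hdot
    exact (mul_eq_right₀ hS').mp hdot.symm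
  rw [hc1, one_smul] at h
  have h2 : (2 : ℝ) • w = 0 := by
    rw [two_smul]
    calc w + w = (x + w) - (x - w) := by abel
      _ = 0 := by rw [h, sub_self]
  exact (smul_eq_zero.mp h2).resolve_left two_ne_zero

/-! ### Non-convexity of the range. -/

theorem exists_norm_eq_one_mul_eq_norm (v : 𝕜) : ∃ c : 𝕜, ‖c‖ = 1 ∧ c * v = (‖v‖ : 𝕜) := by
  by_cases hv : v = 0
  · exact ⟨1, by simp, by simp [hv]⟩
  · exact ⟨(‖v‖ : 𝕜) / v, by simp [hv], div_mul_cancel₀ _ hv⟩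

/-- Averaging over `±γ` cancels the first-order term, leaving an error quadratic in `γ`. -/
theorem sq_half_norm_add_norm_sub_bounds (α γ : 𝕜) :
    ‖α‖ ^ 2 ≤ ((‖α + γ‖ + ‖α - γ‖) / 2) ^ 2 ∧
      ((‖α + γ‖ + ‖α - γ‖) / 2) ^ 2 ≤ ‖α‖ ^ 2 + ‖γ‖ ^ 2 := by
  constructor
  · gcongr
    have h : ‖(2 : 𝕜) * α‖ ≤ ‖α + γ‖ + ‖α - γ‖ := by
      calc ‖(2 : 𝕜) * α‖ = ‖(α + γ) + (α - γ)‖ := by ring_nf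
        _ ≤ _ := norm_add_le _ _
    rw [norm_mul, RCLike.norm_two] at h
    linarith
  · have h := parallelogram_law_with_norm 𝕜 α γ
    nlinarith [sq_nonneg (‖α + γ‖ - ‖α - γ‖)]

/-- If `A` does phase retrieval then the midpoints of `|A (x + t y)|` and `|A (x - t y)|` leave
the range of `|A ·|`, where `x` is in the kernel of a row of `A` and `y` is not. -/
theorem PhaseInjective.not_add_mem_range (hA : PhaseInjective A) {j : Fin m}
    {x y : Fin d → 𝕜} (hx : x ≠ 0) (hjx : (A *ᵥ x) j = 0) (hjy : (A *ᵥ y) j ≠ 0) :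
    ¬ ∀ u ∈ Set.range (absMulVec A), ∀ v ∈ Set.range (absMulVec A),
      u + v ∈ Set.range (absMulVec A) := by
  intro hadd
  let t : ℕ → ℝ := fun n => 1 / ((n : ℝ) + 1)
  have ht0 : ∀ n, 0 < t n := fun n => Nat.one_div_pos_of_nat
  have htl : Tendsto t atTop (𝓝 0) := tendsto_one_div_add_atTop_nhds_zero_nat
  let p : ℝ → EuclideanSpace ℝ (Fin m) := fun s =>
    (1 / 2 : ℝ) • (absMulVec A (x + s • y) + absMulVec A (x - s • y))
  -- Making the pairing with `x` nonnegative fixes the phase of `z`, so that `z` subconverges to `x`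
  -- itself.
  have hpz : ∀ n, ∃ z, absMulVec A z = p (t n) ∧ star x ⬝ᵥ z = (‖star x ⬝ᵥ z‖ : 𝕜) := by
    intro n
    obtain ⟨z, hz⟩ := hadd _ ⟨x + t n • y, rfl⟩ _ ⟨x - t n • y, rfl⟩
    obtain ⟨c, hc, hcz⟩ := exists_norm_eq_one_mul_eq_norm (star x ⬝ᵥ z)
    refine ⟨((1 / 2 : ℝ) : 𝕜) • c • z, ?_, ?_⟩
    · rw [absMulVec_smul, absMulVec_smul, hc, one_smul, hz, RCLike.norm_ofReal,
        abs_of_pos one_half_pos]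
    · rw [dotProduct_smul, dotProduct_smul, smul_eq_mul, smul_eq_mul, hcz, norm_mul,
        RCLike.norm_ofReal, abs_of_pos one_half_pos, RCLike.norm_ofReal, abs_norm,
        RCLike.ofReal_mul]
  choose z hz hzx using hpz
  have hpc : Continuous p := by
    have := continuous_absMulVec A
    fun_prop
  have hp0 : p 0 = absMulVec A x := by
    simp only [p, zero_smul, add_zero, sub_zero]
    rw [← two_smul ℝ (absMulVec A x), smul_smul]
    norm_num
  have hlim : Tendsto (fun n => absMulVec A (z n)) atTop (𝓝 (absMulVec A x)) := by
    simp only [hz, ← hp0]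
    exact (hpc.tendsto 0).comp htl
  obtain ⟨a, φ, hφ, ha⟩ := hA.exists_tendsto_subseq hlim
  have hax : a = x := by
    obtain ⟨c, hc, rfl⟩ := hA a x (tendsto_nhds_unique
      (((continuous_absMulVec A).tendsto a).comp ha) (hlim.comp hφ.tendsto_atTop))
    obtain ⟨S, hS, hSx⟩ := star_dotProduct_self_eq_ofReal hx
    have hdc : Continuous fun v : Fin d → 𝕜 => star x ⬝ᵥ v := by fun_prop
    have h1 := (hdc.tendsto (c • x)).comp ha
    have h2 : Tendsto (fun n => (‖star x ⬝ᵥ (z (φ n))‖ : 𝕜)) atTop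
        (𝓝 (‖star x ⬝ᵥ (c • x)‖ : 𝕜)) :=
      (RCLike.continuous_ofReal.tendsto _).comp h1.norm
    have h3 := tendsto_nhds_unique (h1.congr fun n => hzx (φ n)) h2
    rw [dotProduct_smul, smul_eq_mul, norm_mul, hc, one_mul, hSx, RCLike.norm_ofReal,
      abs_of_pos hS] at h3
    have hS' : (S : 𝕜) ≠ 0 := RCLike.ofReal_ne_zero.mpr hS.ne'
    rw [(mul_eq_right₀ hS').mp h3, one_smul]
  subst hax
  obtain ⟨N, -, hN⟩ := (phaseDifferential A a).exists_antilipschitzWith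
    (hA.ker_phaseDifferential hx)
  obtain ⟨B, hB0, hB⟩ : ∃ B : ℝ, 0 ≤ B ∧ ∀ v i, ‖(A *ᵥ v) i‖ ≤ B * ‖v‖ := by
    refine ⟨‖A.mulVecLin.toContinuousLinearMap‖, norm_nonneg _, fun v i => ?_⟩
    exact (norm_le_pi_norm (A *ᵥ v) i).trans (A.mulVecLin.toContinuousLinearMap.le_opNorm v)
  set δ := ‖(A *ᵥ y) j‖ with hδ
  have hδ0 : 0 < δ := norm_pos_iff.mpr hjy
  set Q := N * (B ^ 2 * ((B / δ) ^ 2 * ‖y‖ ^ 2 + 1)) with hQ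
  have hlow : ∀ n, 1 ≤ Q * ‖z n - a‖ := by
    intro n
    set w := z n - a with hw
    set s := t n
    have hs : 0 < s := ht0 n
    have hzw : z n = a + w := by rw [hw]; abel
    have hp : ∀ i, ‖(A *ᵥ a) i + (A *ᵥ w) i‖
        = (‖(A *ᵥ a) i + s • (A *ᵥ y) i‖ + ‖(A *ᵥ a) i - s • (A *ᵥ y) i‖) / 2 := by
      intro i
      have h := congrArg (fun v : EuclideanSpace ℝ (Fin m) => v i) (hz n)
      simp only [p, hzw, absMulVec_apply, PiLp.smul_apply, PiLp.add_apply, Matrix.mulVec_add,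
        Matrix.mulVec_sub, Matrix.mulVec_smul, Pi.add_apply, Pi.sub_apply, Pi.smul_apply,
        smul_eq_mul] at h
      rw [h]
      ring
    -- In entry `j`, where `A a` vanishes, `hp` reads `‖(A w) j‖ = s δ`.
    have hsw : s ≤ B / δ * ‖w‖ := by
      have h := hp j
      rw [hjx, zero_add, zero_add, zero_sub, norm_neg, norm_smul, Real.norm_of_nonneg hs.le,
        add_self_div_two] at h
      rw [div_mul_eq_mul_div, le_div_iff₀ hδ0, ← h]
      exact hB w j
    have hw0 : 0 < ‖w‖ := by
      refine (norm_nonneg w).lt_of_ne fun h => ?_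
      rw [← h, mul_zero] at hsw
      linarith
    have hLw : ‖phaseDifferential A a w‖ ≤ B ^ 2 * (s ^ 2 * ‖y‖ ^ 2 + ‖w‖ ^ 2) := by
      rw [norm_prod_le_iff]
      constructor
      · refine (pi_norm_le_iff_of_nonneg (by positivity)).mpr fun i => ?_
        change |RCLike.re (inner 𝕜 ((A *ᵥ a) i) ((A *ᵥ w) i))| ≤ _
        obtain ⟨h1, h2⟩ := sq_half_norm_add_norm_sub_bounds ((A *ᵥ a) i) (s • (A *ᵥ y) i)
        rw [← hp i, norm_add_sq (𝕜 := 𝕜)] at h1 h2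
        rw [norm_smul, Real.norm_of_nonneg hs.le, mul_pow] at h2
        have hy2 : ‖(A *ᵥ y) i‖ ^ 2 ≤ (B * ‖y‖) ^ 2 := by gcongr; exact hB y i
        have hw2 : ‖(A *ᵥ w) i‖ ^ 2 ≤ (B * ‖w‖) ^ 2 := by gcongr; exact hB w i
        have hsy : s ^ 2 * ‖(A *ᵥ y) i‖ ^ 2 ≤ s ^ 2 * (B * ‖y‖) ^ 2 := by gcongr
        have hn1 : 0 ≤ s ^ 2 * (B * ‖y‖) ^ 2 := by positivity
        have hn2 : 0 ≤ (B * ‖w‖) ^ 2 := by positivity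
        have hn3 := sq_nonneg ‖(A *ᵥ w) i‖
        rw [abs_le]
        constructor <;> linarith
      · change |RCLike.im (star a ⬝ᵥ w)| ≤ _
        obtain ⟨S, -, hSa⟩ := star_dotProduct_self_eq_ofReal hx
        rw [hw, dotProduct_sub, hzx n, hSa, map_sub, RCLike.ofReal_im, RCLike.ofReal_im, sub_zero,
          abs_zero]
        positivity
    have hwN := hN.le_mul_dist w 0
    rw [map_zero, dist_zero_right, dist_zero_right] at hwN
    have hfin : ‖w‖ ≤ Q * ‖w‖ * ‖w‖ := by
      calc ‖w‖ ≤ N * (B ^ 2 * (s ^ 2 * ‖y‖ ^ 2 + ‖w‖ ^ 2)) := hwN.trans (by gcongr)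
        _ ≤ N * (B ^ 2 * ((B / δ * ‖w‖) ^ 2 * ‖y‖ ^ 2 + ‖w‖ ^ 2)) := by gcongr
        _ = Q * ‖w‖ * ‖w‖ := by rw [hQ]; ring
    exact le_of_mul_le_mul_right (by simpa using hfin) hw0
  have hlim0 : Tendsto (fun n => Q * ‖z (φ n) - a‖) atTop (𝓝 (Q * ‖a - a‖)) :=
    ((ha.sub_const a).norm).const_mul Q
  have := ge_of_tendsto' hlim0 fun n => hlow (φ n)
  rw [sub_self, norm_zero, mul_zero] at this
  linarith

end PhaseRetrieval

/-! ### Uniqueness for all data is contradictory. -/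

theorem theorem3p1 {𝕜 : Type*} [RCLike 𝕜] (m d : ℕ) (hm : 0 < m) (hd : 0 < d)
    (A : Matrix (Fin m) (Fin d) 𝕜) (hdA : 2 ≤ d ∨ A = 0) :
    ∃ b : EuclideanSpace ℝ (Fin m), (solutionClasses A b).Nontrivial := by
  by_contra hcon
  have huniq : ∀ b, ∀ x ∈ leastSquaresSolutions A b, ∀ y ∈ leastSquaresSolutions A b,
      ∃ c : 𝕜, ‖c‖ = 1 ∧ x = c • y := by
    intro b x hx y hy
    have hs : (solutionClasses A b).Subsingleton :=
      Set.not_nontrivial_iff.mp fun h => hcon ⟨b, h⟩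
    exact Quotient.exact (s := phaseSetoid 𝕜 d) (hs ⟨x, hx, rfl⟩ ⟨y, hy, rfl⟩)
  have hA : PhaseInjective A := by
    intro x y hxy
    -- Both vectors have zero residual.
    refine huniq (absMulVec A y) x ?_ y ?_ <;> intro v
    · simp [hxy]
    · simp
  have hA0 : A ≠ 0 := by
    rintro rfl
    obtain ⟨c, -, hc⟩ := hA (fun _ => 1) 0 (by ext i; simp)
    simpa using congrFun hc ⟨0, hd⟩
  have hd2 : 2 ≤ d := hdA.resolve_right hA0
  obtain ⟨j, k, hjk⟩ : ∃ j k, A j k ≠ 0 := by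
    by_contra! h
    exact hA0 (Matrix.ext h)
  obtain ⟨x, hxk, hx⟩ := (Submodule.ne_bot_iff _).mp
    (LinearMap.ker_ne_bot_of_finrank_lt
      (f := (LinearMap.proj j : (Fin m → 𝕜) →ₗ[𝕜] 𝕜) ∘ₗ A.mulVecLin) (by simp; omega))
  refine hA.not_add_mem_range (j := j) (y := Pi.single k 1) hx ?_ ?_ ?_
  · simpa using hxk
  · simpa using hjk
  · intro u hu v hv
    refine add_mem_of_unique_nearest hA.isClosed_range ?_ ?_ hu hv
    · rintro _ ⟨z, rfl⟩ r hr
      exact ⟨(r : 𝕜) • z, by rw [absMulVec_smul, RCLike.norm_ofReal, abs_of_nonneg hr]⟩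
    · rintro b _ ⟨p, rfl⟩ _ ⟨q, rfl⟩ hp hq
      obtain ⟨c, hc, rfl⟩ := huniq b p (fun y => hp _ ⟨y, rfl⟩) q (fun y => hq _ ⟨y, rfl⟩)
      rw [absMulVec_smul, hc, one_smul]
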